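/- A finite simplicial complex $K$ is a finite set of nonempty finite sets (its simplices) that is closed under passing to nonempty subsets. Let $\mathcal{X}(K)$ be its face poset, that is, the set of simplices of $K$ ordered by inclusion. For a finite poset $X=\{x_1,\dots,x_n\}$ let $X_M=(x_{i,j})$ be the $n\times n$ matrix with $x_{i,j}=0$ if $x_i\le x_j$ and $x_{i,j}=1$ otherwise, and define $\det(K):=|\det(\mathcal{X}(K)_M)|$ (independent of the labelling). There is an elementary collapse from $K$ to $L$ if $K$ has a simplex $\sigma$ that is properly contained in exactly one simplex $\tau$ of $K$, and $L=K\setminus\{\sigma,\tau\}$. Two finite simplicial complexes have the same simple homotopy type if one is obtained from the other by a finite sequence of elementary collapses, inverses of elementary collapses (elementary expansions), and simplicial isomorphisms. Let $K$ and $L$ be finite simplicial complexes. If $K$ and $L$ have the same simple homotopy type, then $\det(K)=\det(L)$. -/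

import Mathlib

universe u

/-- The matrix `X_M = (x_{i,j})` of a poset `X`: `x_{i,j} = 0` if `x_i ≤ x_j`, and `1` otherwise.
Rows and columns are indexed by the points of `X` themselves instead of by a labelling of them. -/
noncomputable def posetMatrix (X : Type*) [PartialOrder X] : Matrix X X ℤ :=
  open Classical in Matrix.of fun x y => if x ≤ y then 0 else 1

/-- The determinant `det X_M` of the matrix of a finite poset `X`. -/
noncomputable def posetDet (X : Type*) [PartialOrder X] [Finite X] : ℤ :=
  open Classical in
  letI : Fintype X := Fintype.ofFinite X
  (posetMatrix X).det

/-- A finite simplicial complex: a finite set of nonempty finite subsets of `Vert`, the simplices,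
which is closed under passing to nonempty subsets. An element `v` of `Vert` is a vertex of the
complex when `{v}` is a simplex; the other elements of `Vert` play no role. -/
structure FiniteSimplicialComplex where
  Vert : Type u
  complex : PreAbstractSimplicialComplex Vert
  finite_faces : complex.faces.Finite

namespace FiniteSimplicialComplex

/-- The set of vertices of a simplicial complex. -/
def vertices (K : FiniteSimplicialComplex.{u}) : Set K.Vert :=
  {v | {v} ∈ K.complex.faces}

/-- The face poset `𝒳(K)`: the simplices of `K`, ordered by inclusion. -/
abbrev FacePoset (K : FiniteSimplicialComplex.{u}) : Type u :=
  {s : Finset K.Vert // s ∈ K.complex.faces}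

instance (K : FiniteSimplicialComplex.{u}) : Finite K.FacePoset :=
  K.finite_faces.to_subtype

/-- `det K = |det 𝒳(K)_M|`. -/
noncomputable def det (K : FiniteSimplicialComplex.{u}) : ℤ :=
  |posetDet K.FacePoset|

/-- `K` and `L` are isomorphic: some bijection between their vertex sets carries the simplices
of `K` exactly onto the simplices of `L`. -/
def IsIsomorphic (K L : FiniteSimplicialComplex.{u}) : Prop :=
  ∃ e : K.vertices ≃ L.vertices, ∀ s : Finset K.vertices,
    s.map (Function.Embedding.subtype _) ∈ K.complex.faces ↔
      (s.map e.toEmbedding).map (Function.Embedding.subtype _) ∈ L.complex.faces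

end FiniteSimplicialComplex

/-- There is an elementary collapse from `K` to `L`: `K` has a simplex `σ` which is a proper face
of exactly one simplex `τ` of `K`, and `L` is obtained from `K` by removing `σ` and `τ`. -/
def IsElementaryCollapse {V : Type u} (K L : PreAbstractSimplicialComplex V) : Prop :=
  ∃ σ ∈ K.faces, ∃ τ ∈ K.faces, σ ⊂ τ ∧ (∀ ρ ∈ K.faces, σ ⊂ ρ → ρ = τ) ∧
    L.faces = K.faces \ {σ, τ}

namespace FiniteSimplicialComplex

/-- One step: an isomorphism of simplicial complexes or an elementary collapse. -/
inductive SimpleStep : FiniteSimplicialComplex.{u} → FiniteSimplicialComplex.{u} → Prop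
  | iso {K L : FiniteSimplicialComplex.{u}} (h : K.IsIsomorphic L) : SimpleStep K L
  | collapse {V : Type u} {K L : PreAbstractSimplicialComplex V} (hK : K.faces.Finite)
      (hL : L.faces.Finite) (h : IsElementaryCollapse K L) : SimpleStep ⟨V, K, hK⟩ ⟨V, L, hL⟩

/-- `K` and `L` have the same simple homotopy type: they are joined by a finite sequence of
elementary collapses, elementary expansions (the inverse moves) and isomorphisms. -/
def SameSimpleHomotopyType (K L : FiniteSimplicialComplex.{u}) : Prop :=
  Relation.EqvGen SimpleStep K L

end FiniteSimplicialComplex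

/-! Up to sign, the determinant is the reduced Euler characteristic: `det K = |1 - χ(K)|`. With `Z`
the zeta matrix of the face poset and `J` the all-ones matrix, the poset matrix is `J - Z`. Since
`det Z = 1` and the row `(-1) ^ #s` times `Z` is constantly `-1` (`sum_faces_le`), this is a
rank-one perturbation of the identity times `-Z`, whose determinant is explicit (`det_posetMatrix`).
Collapses and isomorphisms preserve `χ`. -/

/-- The zeta matrix of a family of finite sets ordered by inclusion has determinant one. -/
theorem det_zeta_finset {V : Type*} {p : Finset V → Prop} [Fintype (Subtype p)]
    [DecidableEq (Subtype p)] (Z : Matrix (Subtype p) (Subtype p) ℤ)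
    (hZ : ∀ s t, Z s t = open Classical in if s ≤ t then 1 else 0) :
    Z.det = 1 := by
  classical
  -- Grading by cardinality: inclusion between sets of equal size is equality, so the diagonal
  -- blocks are identities.
  have hb : Z.BlockTriangular fun s : Subtype p => s.1.card := by
    intro s t hst
    rw [hZ, if_neg]
    intro hle
    exact absurd (Finset.card_le_card hle) (not_le.mpr hst)
  rw [hb.det]
  refine Finset.prod_eq_one fun k _ => ?_
  have h1 : Z.toSquareBlock (fun s : Subtype p => s.1.card) k = 1 := by
    ext ⟨s, hs⟩ ⟨t, ht⟩
    simp only [Matrix.toSquareBlock_def, Matrix.of_apply, hZ, Matrix.one_apply, Subtype.mk.injEq]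
    refine if_congr ⟨fun hle => ?_, fun h => h.le⟩ rfl rfl
    exact Subtype.ext (Finset.eq_of_subset_of_card_le hle (ht.trans hs.symm).le)
  rw [h1, Matrix.det_one]

namespace PreAbstractSimplicialComplex

/-- The sum of `(-1) ^ #s` over the simplices `s`, the negative of the Euler characteristic. -/
noncomputable def signedFaceCount {V : Type*} (K : PreAbstractSimplicialComplex V) : ℤ :=
  ∑ᶠ s ∈ K.faces, (-1) ^ s.card

/-- Alternating sum over the nonempty faces of a simplex. -/
theorem sum_faces_le {V : Type*} (K : PreAbstractSimplicialComplex V) 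
    [Fintype {s // s ∈ K.faces}] (t : {s // s ∈ K.faces}) :
    (∑ s : {s // s ∈ K.faces}, open Classical in if s ≤ t then (-1 : ℤ) ^ s.1.card else 0) = -1 := by
  classical
  have ht : t.1.Nonempty := (K.isRelLowerSet_faces t.2).1
  have h0 := Finset.sum_powerset_neg_one_pow_card_of_nonempty ht
  -- The alternating sum over all subsets is `0`; the empty set, not a simplex, accounts for `1` of
  -- it.
  rw [← Finset.add_sum_erase _ _ (Finset.empty_mem_powerset t.1)] at h0
  have h1 : (∑ s : {s // s ∈ K.faces}, if s ≤ t then (-1 : ℤ) ^ s.1.card else 0) =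
      ∑ s ∈ t.1.powerset.erase ∅, (-1 : ℤ) ^ s.card := by
    rw [← Finset.sum_filter]
    refine Finset.sum_bij (fun s _ => s.1) ?_ (fun _ _ _ _ h => Subtype.ext h) ?_ (fun _ _ => rfl)
    · intro s hs
      rw [Finset.mem_erase, Finset.mem_powerset]
      exact ⟨(K.isRelLowerSet_faces s.2).1.ne_empty, (Finset.mem_filter.mp hs).2⟩
    · intro s hs
      rw [Finset.mem_erase, Finset.mem_powerset] at hs
      exact ⟨⟨s, (K.isRelLowerSet_faces t.2).2 hs.2 (Finset.nonempty_iff_ne_empty.mpr hs.1)⟩,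
        Finset.mem_filter.mpr ⟨Finset.mem_univ _, hs.2⟩, rfl⟩
  rw [h1]
  simp only [Finset.card_empty, pow_zero] at h0
  linarith

theorem signedFaceCount_eq_of_isElementaryCollapse {V : Type u}
    {K L : PreAbstractSimplicialComplex V} (hK : K.faces.Finite) (h : IsElementaryCollapse K L) :
    K.signedFaceCount = L.signedFaceCount := by
  classical
  obtain ⟨σ, hσ, τ, hτ, hlt, huniq, hL⟩ := h
  obtain ⟨v, hvτ, hvσ⟩ := Finset.exists_of_ssubset hlt
  -- Uniqueness of `τ` forces it to have just one more vertex than `σ`, so their signs cancel.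
  have hins : insert v σ = τ := by
    refine huniq _ ?_ (Finset.ssubset_insert hvσ)
    exact (K.isRelLowerSet_faces hτ).2 (Finset.insert_subset hvτ hlt.subset)
      (Finset.insert_nonempty _ _)
  have hcard : τ.card = σ.card + 1 := by rw [← hins, Finset.card_insert_of_notMem hvσ]
  have hsub : ({σ, τ} : Set (Finset V)) ⊆ K.faces := by
    rintro s (rfl | rfl) <;> assumption
  rw [signedFaceCount, signedFaceCount, hL, ← finsum_mem_add_sdiff hsub hK,
    finsum_mem_pair hlt.ne, hcard, pow_succ]
  ring

end PreAbstractSimplicialComplex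

namespace FiniteSimplicialComplex

theorem det_posetMatrix (K : FiniteSimplicialComplex.{u}) [Fintype K.FacePoset]
    [DecidableEq K.FacePoset] :
    (posetMatrix K.FacePoset).det =
      (-1) ^ Fintype.card K.FacePoset * (1 + ∑ s : K.FacePoset, (-1) ^ s.1.card) := by
  classical
  have hZ := det_zeta_finset (p := (· ∈ K.complex.faces))
    (Matrix.of fun s t => if s ≤ t then 1 else 0) fun _ _ => rfl
  generalize hZdef : (Matrix.of fun s t : K.FacePoset => if s ≤ t then (1 : ℤ) else 0) = Z at hZ
  have hZst : ∀ s t, Z s t = if s ≤ t then 1 else 0 := fun s t => by rw [← hZdef]; rfl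
  let A : Matrix K.FacePoset Unit ℤ := Matrix.replicateCol Unit fun _ => 1
  let B : Matrix Unit K.FacePoset ℤ := Matrix.replicateRow Unit fun s => (-1) ^ s.1.card
  have hBZ : B * Z = Matrix.replicateRow Unit fun _ => -1 := by
    ext i t
    rw [Matrix.mul_apply, Matrix.replicateRow_apply, ← K.complex.sum_faces_le t]
    refine Finset.sum_congr rfl fun s _ => ?_
    simp [B, hZst]
  -- `A * (B * Z) = -J`, so the right side is `J - Z`.
  have hM : posetMatrix K.FacePoset = -((1 + A * B) * Z) := by
    rw [add_mul, Matrix.one_mul, Matrix.mul_assoc, hBZ]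
    ext s t
    by_cases h : s ≤ t <;> simp [posetMatrix, A, hZst, h, Matrix.mul_apply]
  rw [hM, Matrix.det_neg, Matrix.det_mul, hZ, mul_one,
    Matrix.det_one_add_replicateCol_mul_replicateRow]
  simp [dotProduct]

theorem det_eq_abs (K : FiniteSimplicialComplex.{u}) :
    K.det = |1 + K.complex.signedFaceCount| := by
  classical
  let _ : Fintype K.FacePoset := Fintype.ofFinite _
  have hsum : K.complex.signedFaceCount = ∑ s : K.FacePoset, (-1) ^ s.1.card := by
    rw [PreAbstractSimplicialComplex.signedFaceCount, ← finsum_eq_sum_of_fintype]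
    exact (finsum_subtype_eq_finsum_cond _).symm
  rw [det, posetDet, det_posetMatrix, abs_mul, abs_pow, abs_neg, abs_one, one_pow, one_mul, hsum]

/-- Isomorphisms act only on actual vertices, so face sums are first moved to finsets of vertices;
every simplex is one, as its singletons are faces. -/
theorem bijOn_map_subtype_vertices (K : FiniteSimplicialComplex.{u}) :
    Set.BijOn (fun s : Finset K.vertices => s.map (Function.Embedding.subtype _))
      {s | s.map (Function.Embedding.subtype _) ∈ K.complex.faces} K.complex.faces := by
  classical
  refine ⟨fun s hs => hs, (Finset.map_injective _).injOn, fun s hs => ?_⟩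
  have hv : ∀ v ∈ s, v ∈ K.vertices := fun v hv =>
    (K.complex.isRelLowerSet_faces hs).2 (Finset.singleton_subset_iff.mpr hv)
      (Finset.singleton_nonempty v)
  have h := Finset.subtype_map_of_mem hv
  exact ⟨s.subtype (· ∈ K.vertices), by rw [Set.mem_ofPred_eq]; exact h.symm ▸ hs, h⟩

theorem IsIsomorphic.signedFaceCount_eq {K L : FiniteSimplicialComplex.{u}}
    (h : K.IsIsomorphic L) : K.complex.signedFaceCount = L.complex.signedFaceCount := by
  obtain ⟨e, he⟩ := h
  have hfg : ∀ M : FiniteSimplicialComplex.{u}, M.complex.signedFaceCount =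
      ∑ᶠ s ∈ {s : Finset M.vertices | s.map (Function.Embedding.subtype _) ∈ M.complex.faces},
        (-1) ^ s.card := fun M =>
    (finsum_mem_eq_of_bijOn _ M.bijOn_map_subtype_vertices fun s _ => by
      rw [Finset.card_map]).symm
  rw [hfg K, hfg L]
  refine finsum_mem_eq_of_bijOn (fun s => s.map e.toEmbedding)
    ⟨fun s hs => (he s).mp hs, (Finset.map_injective _).injOn, fun t ht => ?_⟩
    fun s _ => by rw [Finset.card_map]
  have hmap : (t.map e.symm.toEmbedding).map e.toEmbedding = t := by
    ext; simp
  exact ⟨t.map e.symm.toEmbedding, (he _).mpr (by rw [hmap]; exact ht), hmap⟩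

theorem SimpleStep.signedFaceCount_eq {K L : FiniteSimplicialComplex.{u}} (h : SimpleStep K L) :
    K.complex.signedFaceCount = L.complex.signedFaceCount := by
  cases h with
  | iso h => exact h.signedFaceCount_eq
  | collapse hK _ h =>
    exact PreAbstractSimplicialComplex.signedFaceCount_eq_of_isElementaryCollapse hK h

end FiniteSimplicialComplex

theorem mainTheorem7 (K L : FiniteSimplicialComplex.{u})
    (h : K.SameSimpleHomotopyType L) : K.det = L.det := by
  have hKL : K.complex.signedFaceCount = L.complex.signedFaceCount := by
    induction h with
    | rel _ _ h => exact h.signedFaceCount_eq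
    | refl _ => rfl
    | symm _ _ _ ih => exact ih.symm
    | trans _ _ _ _ _ ih₁ ih₂ => exact ih₁.trans ih₂
  rw [K.det_eq_abs, L.det_eq_abs, hKL]
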